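/- **Theorem 1 (posterior consistency of PS-BAX).** Let $\mathbb{X}$ be a finite set and let $\mathcal{O}_{\mathcal{A}}$ be the (Borel measurable) map sending a function $f:\mathbb{X}\to\mathbb{R}$ to the target set $\mathcal{O}_{\mathcal{A}}(f)\subset\mathbb{X}$ computed by the base algorithm $\mathcal{A}$. Assume that the target set is complement-independent: for all $f,f':\mathbb{X}\to\mathbb{R}$, $\mathcal{O}_{\mathcal{A}}(f)=\mathcal{O}_{\mathcal{A}}(f')$ whenever there is a set $S$ with $\mathcal{O}_{\mathcal{A}}(f)\cup\mathcal{O}_{\mathcal{A}}(f')\subset S$ and $f(x)=f'(x)$ for all $x\in S$. Let $f$ be drawn from a Gaussian process prior on $\mathbb{X}$, let $y_n=f(x_n)+\epsilon_n$ be the $n$-th evaluation, where $\epsilon_1,\epsilon_2,\dots$ are i.i.d. $\mathcal{N}(0,\sigma^2)$ with $\sigma^2\ge 0$, each $\epsilon_n$ being independent of $f$ and of everything that precedes the evaluation of $f$ at $x_n$ (previous evaluations, and the choices up to and including $x_n$). Let $\mathcal{D}_{n-1}=\{(x_k,y_k)\}_{k=1}^{n-1}$, let $\mathbf{P}_n$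 be the posterior distribution of $f$ given $\mathcal{D}_{n-1}$, and let $\sigma_n(x)$ be the standard deviation of $f(x)$ under $\mathbf{P}_n$. Suppose that, possibly after finitely many arbitrary initial evaluations, the points are chosen by PS-BAX, that is, at each step $n$: 1. a set $X_n\subset\mathbb{X}$ is sampled according to the posterior distribution of the target set: conditionally on $f$ and on everything that happened in the previous steps, $X_n=X$ with probability $\mathbf{P}_n(\mathcal{O}_{\mathcal{A}}(f)=X)$, for each $X\subset\mathbb{X}$ (for instance $X_n=\mathcal{O}_{\mathcal{A}}(\tilde f_n)$ with $\tilde f_n$ freshly drawn from the posterior of $f$ given $\mathcal{D}_{n-1}$); 2. $x_n\in\arg\max_{x\in X_n}\sigma_n(x)$, with ties broken in any way (and $x_n\in\mathbb{X}$ arbitrary if $X_n=\emptyset$). Then, for each $X\subset\mathbb{X}$, $$\lim_{n\to\infty}\mathbf{P}_n(\mathcal{O}_{\mathcal{A}}(f)=X)=\mathbf{1}\{\mathcal{O}_{\mathcal{A}}(f)=X\}\quad\text{almost surely.}$$ -/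

import Mathlib

open MeasureTheory ProbabilityTheory Filter Topology
open scoped NNReal

namespace PSBAX

/-- The target-set map `O` (sending a function `f : 𝕏 → ℝ` to the output `O f ⊆ 𝕏` of the base
algorithm on `f`) is *complement-independent*: `O f = O f'` whenever `f` and `f'` agree on some
set containing both `O f` and `O f'`. -/
def ComplementIndependent {𝕏 : Type*} (O : (𝕏 → ℝ) → Set 𝕏) : Prop :=
  ∀ f f' : 𝕏 → ℝ, (∃ S : Set 𝕏, O f ∪ O f' ⊆ S ∧ ∀ x ∈ S, f x = f' x) → O f = O f'

section Model

variable {Ω 𝕏 : Type*}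

/-- The `n`-th noisy evaluation `y_n = f(x_n) + ε_n`. -/
def obs (f : Ω → 𝕏 → ℝ) (ε : ℕ → Ω → ℝ) (x : ℕ → Ω → 𝕏) (n : ℕ) (ω : Ω) : ℝ :=
  f ω (x n ω) + ε n ω

/-- The data `((x_k, y_k))_{k < n}` available after `n` evaluations (steps are numbered from `0`,
so this is what is known when the point `x_n` has to be chosen). -/
def data (f : Ω → 𝕏 → ℝ) (ε : ℕ → Ω → ℝ) (x : ℕ → Ω → 𝕏) (n : ℕ) (ω : Ω) : Fin n → 𝕏 × ℝ :=
  fun k => (x k ω, obs f ε x k ω)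

/-- Everything that is determined before step `n`: the function `f` itself, and the sampled target
sets, evaluation points and observations of all previous steps (hence also the previous noise). -/
def history (f : Ω → 𝕏 → ℝ) (ε : ℕ → Ω → ℝ) (X : ℕ → Ω → Set 𝕏) (x : ℕ → Ω → 𝕏) (n : ℕ) (ω : Ω) :
    (𝕏 → ℝ) × (Fin n → Set 𝕏 × 𝕏 × ℝ) :=
  (f ω, fun k => (X k ω, x k ω, obs f ε x k ω))

variable [MeasurableSpace Ω] [Finite 𝕏] [MeasurableSpace 𝕏]

/-- The posterior distribution of `f` given the data of the first `n` evaluations: the regular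
conditional distribution of `f` given `data f ε x n`, evaluated at the observed data. -/
noncomputable def posteriorLaw (P : Measure Ω) [IsProbabilityMeasure P]
    (f : Ω → 𝕏 → ℝ) (ε : ℕ → Ω → ℝ) (x : ℕ → Ω → 𝕏) (n : ℕ) (ω : Ω) : Measure (𝕏 → ℝ) :=
  condDistrib f (data f ε x n) P (data f ε x n ω)

/-- The posterior standard deviation of `f(z)` given the data of the first `n` evaluations. -/
noncomputable def posteriorSD (P : Measure Ω) [IsProbabilityMeasure P]
    (f : Ω → 𝕏 → ℝ) (ε : ℕ → Ω → ℝ) (x : ℕ → Ω → 𝕏) (n : ℕ) (ω : Ω) (z : 𝕏) : ℝ :=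
  √(Var[fun g : 𝕏 → ℝ => g z; posteriorLaw P f ε x n ω])

/-- The probabilistic model: `f` is drawn from a Gaussian process prior (arbitrary mean and
covariance, possibly degenerate), and the `n`-th evaluation is corrupted by `N(0, σsq)` noise that
is independent of everything determined before it, including the choice of `x_n`. In particular the
noise variables are i.i.d. and independent of `f`. -/
structure IsGPModel (P : Measure Ω) [IsProbabilityMeasure P] (σsq : ℝ≥0)
    (f : Ω → 𝕏 → ℝ) (ε : ℕ → Ω → ℝ) (X : ℕ → Ω → Set 𝕏) (x : ℕ → Ω → 𝕏) : Prop where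
  measurable_f : Measurable f
  gaussian_prior : IsGaussianProcess (fun z ω => f ω z) P
  measurable_noise : ∀ n, Measurable (ε n)
  noise_law : ∀ n, P.map (ε n) = gaussianReal 0 σsq
  noise_indep : ∀ n, IndepFun (ε n) (fun ω => (history f ε X x n ω, X n ω, x n ω)) P

/-- The points `x_n`, `n ≥ n₀`, are chosen by PS-BAX, with `X_n` the target set sampled at step `n`.
The first `n₀` evaluations are the initial dataset (`n₀ = 0`: no initial data); their points, and
the sets `X_n` for `n < n₀`, are arbitrary. At each step `n ≥ n₀`:
* `X_n` is sampled according to the posterior probability of being the target set, with fresh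
  randomness: given everything determined before step `n`, it equals `Z` with the posterior
  probability of `O f = Z` (as is the case for `X_n = O f̃_n` with `f̃_n` a posterior sample of `f`);
* `x_n` maximizes the posterior standard deviation over `X_n`. Ties are broken in any way, and the
  evaluated point is not restricted when there is nothing to maximize over (`X_n = ∅`). -/
structure IsPSBAX (P : Measure Ω) [IsProbabilityMeasure P] (n₀ : ℕ)
    (O : (𝕏 → ℝ) → Set 𝕏)
    (f : Ω → 𝕏 → ℝ) (ε : ℕ → Ω → ℝ) (X : ℕ → Ω → Set 𝕏) (x : ℕ → Ω → 𝕏) : Prop where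
  measurable_set : ∀ n, Measurable (X n)
  measurable_point : ∀ n, Measurable (x n)
  posterior_sampling : ∀ n, n₀ ≤ n → ∀ Z : Set 𝕏,
    P[{ω | X n ω = Z}.indicator (fun _ => (1 : ℝ)) |
        MeasurableSpace.comap (history f ε X x n) inferInstance]
      =ᵐ[P] fun ω => (posteriorLaw P f ε x n ω).real {g | O g = Z}
  argmax : ∀ n, n₀ ≤ n → ∀ᵐ ω ∂P, (X n ω).Nonempty →
    x n ω ∈ X n ω ∧ IsMaxOn (posteriorSD P f ε x n ω) (X n ω) (x n ω)

end Model

end PSBAX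

/-! Posterior probabilities are bounded martingales, so they converge to the posterior given all
evaluations, `limitLaw`; the task is to show that this limit charges only the true target set. A set
`Z` of positive limiting mass is sampled infinitely often, by the conditional Borel–Cantelli lemma
(`frequently_sampled`). As `𝕏` is finite, some `w` in `Z` is then evaluated infinitely often as the
maximizer over `Z`. Averaging the observations at `w` drives its limiting variance to zero
(`condVar_eq_zero_of_frequently_visited`), and maximality of `w` carries this over to all of `Z`
(`sd_limit_nonpos_of_frequently_sampled`). Under the limiting law, `f` is thus almost surely
constant at each point of every charged target set. Complement-independence, applied on the union of
two such sets, makes them equal (`eq_of_ae_known`). The true target set is charged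
(`limitLaw_target_pos`), so it carries all the mass. Gaussianity enters only through square
integrability of the prior and the mean and variance of the noise. -/

namespace PSBAX

/-! ### Conditional variances: an approximation bound and Lévy convergence. -/

section CondVar

variable {Ω : Type*}

/-- An `m`-measurable approximation of a random variable bounds its conditional variance. -/
theorem setIntegral_condVar_le {m m₀ : MeasurableSpace Ω} {P : Measure[m₀] Ω} [IsFiniteMeasure P]
    (hm : m ≤ m₀) {U Y : Ω → ℝ} (hU : MemLp U 2 P) (hY : MemLp Y 2 P)
    (hYm : StronglyMeasurable[m] Y) {s : Set Ω} (hs : MeasurableSet[m] s) :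
    ∫ ω in s, condVar m U P ω ∂P ≤ ∫ ω in s, (U ω - Y ω) ^ 2 ∂P := by
  have hW : MemLp (U - Y) 2 P := hU.sub hY
  -- Subtracting a variable known to `m` leaves the conditional variance unchanged.
  have hcongr : condVar m U P =ᵐ[P] condVar m (U - Y) P := by
    refine condExp_congr_ae ?_
    filter_upwards [condExp_sub (hU.integrable one_le_two) (hY.integrable one_le_two) m] with ω hω
    simp only [Pi.pow_apply, Pi.sub_apply, hω]
    rw [condExp_of_stronglyMeasurable hm hYm (hY.integrable one_le_two)]
    ring
  calc ∫ ω in s, condVar m U P ω ∂P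
      ≤ ∫ ω in s, (P[(U - Y) ^ 2 | m]) ω ∂P := by
        refine setIntegral_mono_ae integrable_condVar.integrableOn integrable_condExp.integrableOn ?_
        filter_upwards [hcongr, condVar_ae_le_condExp_sq hm hW] with ω h1 h2
        rw [h1]; exact h2
    _ = ∫ ω in s, (U ω - Y ω) ^ 2 ∂P := setIntegral_condExp hm hW.integrable_sq hs

theorem condVar_ae_nonneg {m m₀ : MeasurableSpace Ω} {P : Measure[m₀] Ω} (U : Ω → ℝ) :
    0 ≤ᵐ[P] condVar m U P :=
  condExp_nonneg (Eventually.of_forall fun _ => sq_nonneg _)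

theorem tendsto_ae_condVar {m₀ : MeasurableSpace Ω} {P : Measure[m₀] Ω} [IsFiniteMeasure P]
    (ℱ : Filtration ℕ m₀) {U : Ω → ℝ} (hU : MemLp U 2 P) :
    ∀ᵐ ω ∂P, Tendsto (fun n => condVar (ℱ n) U P ω) atTop (𝓝 (condVar (⨆ n, ℱ n) U P ω)) := by
  have hall : ∀ᵐ ω ∂P, ∀ n, condVar (ℱ n) U P ω = (P[U ^ 2 | ℱ n] - P[U | ℱ n] ^ 2 : Ω → ℝ) ω :=
    ae_all_iff.2 fun n => condVar_ae_eq_condExp_sq_sub_sq_condExp (ℱ.le n) hU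
  filter_upwards [hall, condVar_ae_eq_condExp_sq_sub_sq_condExp (iSup_le ℱ.le) hU,
    tendsto_ae_condExp (μ := P) (ℱ := ℱ) (U ^ 2), tendsto_ae_condExp (μ := P) (ℱ := ℱ) U]
    with ω h1 h2 h3 h4
  simp only [h1, h2]
  exact h3.sub (h4.pow 2)

end CondVar

/-! ### Kernel variances as conditional variances. -/

section CondDistrib

variable {Ω β 𝕏 : Type*} [MeasurableSpace Ω] [MeasurableSpace β] [Finite 𝕏]

theorem memLp_eval_condDistrib {P : Measure Ω} [IsProbabilityMeasure P] {W : Ω → β}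
    (hW : Measurable W) {f : Ω → 𝕏 → ℝ} (hf : Measurable f) {z : 𝕏}
    (hz : MemLp (fun ω => f ω z) 2 P) :
    ∀ᵐ ω ∂P, MemLp (fun g : 𝕏 → ℝ => g z) 2 (condDistrib f W P (W ω)) := by
  have hint : Integrable (fun p : β × (𝕏 → ℝ) => p.2 z ^ 2) (P.map fun ω => (W ω, f ω)) := by
    rw [integrable_map_measure (by fun_prop) (by fun_prop)]
    exact hz.integrable_sq
  filter_upwards [hint.condDistrib_ae hW.aemeasurable hf.aemeasurable] with ω hω
  exact (memLp_two_iff_integrable_sq (measurable_pi_apply z).aestronglyMeasurable).2 hω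

/-- The variance under the regular conditional distribution is the conditional variance. -/
theorem variance_condDistrib_ae_eq_condVar {P : Measure Ω} [IsProbabilityMeasure P] {W : Ω → β}
    (hW : Measurable W) {f : Ω → 𝕏 → ℝ} (hf : Measurable f) {z : 𝕏}
    (hz : MemLp (fun ω => f ω z) 2 P) :
    (fun ω => Var[fun g : 𝕏 → ℝ => g z; condDistrib f W P (W ω)])
      =ᵐ[P] condVar (MeasurableSpace.comap W inferInstance) (fun ω => f ω z) P := by
  have h1 := condExp_ae_eq_integral_condDistrib (μ := P) hW hf.aemeasurable
    (f := fun g : 𝕏 → ℝ => g z) (measurable_pi_apply z).stronglyMeasurable (hz.integrable one_le_two)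
  have h2 := condExp_ae_eq_integral_condDistrib (μ := P) hW hf.aemeasurable
    (f := fun g : 𝕏 → ℝ => g z ^ 2) ((measurable_pi_apply z).pow_const 2).stronglyMeasurable hz.integrable_sq
  filter_upwards [memLp_eval_condDistrib hW hf hz, h1, h2,
    condVar_ae_eq_condExp_sq_sub_sq_condExp hW.comap_le hz] with ω hω h1 h2 h3
  rw [variance_eq_sub hω, h3, Pi.sub_apply, Pi.pow_apply, h1]
  congr 1
  exact h2.symm

end CondDistrib

/-! ### Orthogonality of predictably selected noise. -/

section Noise

variable {Ω : Type*} [MeasurableSpace Ω] {P : Measure Ω}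

/-- The second moment of a sum of centred noise variables, each of them independent of the past and
selected by an event of the past. -/
theorem integral_sq_sum_indicator_noise {ε : ℕ → Ω → ℝ} {v : ℝ} {A : ℕ → Set Ω}
    {𝒢 : ℕ → MeasurableSpace Ω} (hle : ∀ n, 𝒢 n ≤ ‹MeasurableSpace Ω›)
    (hε : ∀ n, MemLp (ε n) 2 P) (hmean : ∀ n, ∫ ω, ε n ω ∂P = 0)
    (hvar : ∀ n, ∫ ω, ε n ω ^ 2 ∂P = v)
    (hindep : ∀ n, Indep (MeasurableSpace.comap (ε n) inferInstance) (𝒢 n) P)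
    (hA : ∀ n, MeasurableSet[𝒢 n] (A n))
    (hS : ∀ n, Measurable[𝒢 n] fun ω => ∑ k ∈ Finset.range n, (A k).indicator (ε k) ω) (n : ℕ) :
    ∫ ω, (∑ k ∈ Finset.range n, (A k).indicator (ε k) ω) ^ 2 ∂P
      = v * ∑ k ∈ Finset.range n, P.real (A k) := by
  have hA' : ∀ n, MeasurableSet (A n) := fun n => hle n _ (hA n)
  have hSL : ∀ n, MemLp (fun ω => ∑ k ∈ Finset.range n, (A k).indicator (ε k) ω) 2 P := fun n =>
    memLp_finsetSum _ fun k _ => (hε k).indicator (hA' k)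
  induction n with
  | zero => simp
  | succ n ih =>
    set S : Ω → ℝ := fun ω => ∑ k ∈ Finset.range n, (A k).indicator (ε k) ω with hSdef
    have hSA : MemLp ((A n).indicator S) 2 P := (hSL n).indicator (hA' n)
    have indep1 : IndepFun (ε n) ((A n).indicator S) P := by
      rw [IndepFun_iff_Indep]
      exact indep_of_indep_of_le_right (hindep n) (((hS n).indicator (hA n)).comap_le)
    have hsq : Measurable fun t : ℝ => t ^ 2 := by fun_prop
    have indep2 : IndepFun (fun ω => ε n ω ^ 2) ((A n).indicator fun _ => (1 : ℝ)) P := by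
      have : IndepFun (ε n) ((A n).indicator fun _ => (1 : ℝ)) P := by
        rw [IndepFun_iff_Indep]
        exact indep_of_indep_of_le_right (hindep n)
          ((measurable_const.indicator (hA n)).comap_le)
      exact this.comp hsq measurable_id
    -- Earlier noise and the selection event both belong to the past, so the centred new noise is
    -- orthogonal to their product.
    have cross : ∫ ω, ε n ω * (A n).indicator S ω ∂P = 0 := by
      rw [indep1.integral_fun_mul_eq_mul_integral (hε n).1 hSA.1, hmean n, zero_mul]
    have diag : ∫ ω, ε n ω ^ 2 * (A n).indicator (fun _ => (1 : ℝ)) ω ∂P = v * P.real (A n) := by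
      rw [indep2.integral_fun_mul_eq_mul_integral (hε n).integrable_sq.1
        ((stronglyMeasurable_const.indicator (hA' n)).aestronglyMeasurable), hvar n,
        integral_indicator_const _ (hA' n)]
      simp
    have i1 : Integrable (fun ω => S ω ^ 2) P := (hSL n).integrable_sq
    have i2 : Integrable (fun ω => 2 * (ε n ω * (A n).indicator S ω)) P :=
      ((hε n).integrable_mul hSA).const_mul 2
    have i3 : Integrable (fun ω => ε n ω ^ 2 * (A n).indicator (fun _ => (1 : ℝ)) ω) P := by
      have : Integrable ((A n).indicator fun ω => ε n ω ^ 2) P :=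
        (hε n).integrable_sq.indicator (hA' n)
      refine this.congr (Eventually.of_forall fun ω => ?_)
      by_cases h : ω ∈ A n <;> simp [h]
    have expand : (fun ω => (∑ k ∈ Finset.range (n + 1), (A k).indicator (ε k) ω) ^ 2) =
        fun ω => S ω ^ 2 + 2 * (ε n ω * (A n).indicator S ω)
          + ε n ω ^ 2 * (A n).indicator (fun _ => (1 : ℝ)) ω := by
      funext ω
      rw [Finset.sum_range_succ]
      by_cases h : ω ∈ A n
      · simp only [Set.indicator_of_mem h, hSdef]; ring
      · simp [h, hSdef]
    have hadd := integral_add (i1.add i2) i3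
    simp only [Pi.add_apply] at hadd
    rw [expand, hadd, integral_add i1 i2, integral_const_mul, cross, diag, ih,
      Finset.sum_range_succ]
    ring

end Noise

/-! ### Data and history filtrations; counting visits. -/

section Measurability

variable {Ω 𝕏 : Type*} [MeasurableSpace Ω] [Finite 𝕏] [MeasurableSpace 𝕏]
  [MeasurableSingletonClass 𝕏] {f : Ω → 𝕏 → ℝ} {ε : ℕ → Ω → ℝ} {X : ℕ → Ω → Set 𝕏} {x : ℕ → Ω → 𝕏}

theorem measurable_eval_random_point {n : ℕ} (hf : Measurable f) (hx : Measurable (x n)) :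
    Measurable fun ω => f ω (x n ω) := by
  have h : Measurable fun p : 𝕏 × (𝕏 → ℝ) => p.2 p.1 :=
    measurable_from_prod_countable_right fun z => measurable_pi_apply z
  exact h.comp (hx.prodMk hf)

theorem measurable_obs {n : ℕ} (hf : Measurable f) (hε : Measurable (ε n)) (hx : Measurable (x n)) :
    Measurable (obs f ε x n) :=
  (measurable_eval_random_point hf hx).add hε

/-- The whole infinite sequence of evaluations. -/
def dataSeq (f : Ω → 𝕏 → ℝ) (ε : ℕ → Ω → ℝ) (x : ℕ → Ω → 𝕏) (ω : Ω) : ℕ → 𝕏 × ℝ :=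
  fun k => (x k ω, obs f ε x k ω)

/-- The information contained in all evaluations. -/
abbrev dataSigma (f : Ω → 𝕏 → ℝ) (ε : ℕ → Ω → ℝ) (x : ℕ → Ω → 𝕏) : MeasurableSpace Ω :=
  MeasurableSpace.comap (dataSeq f ε x) inferInstance

theorem measurable_data (hf : Measurable f) (hε : ∀ n, Measurable (ε n))
    (hx : ∀ n, Measurable (x n)) (n : ℕ) : Measurable (data f ε x n) :=
  measurable_pi_lambda _ fun k => (hx k).prodMk (measurable_obs hf (hε k) (hx k))

theorem measurable_dataSeq (hf : Measurable f) (hε : ∀ n, Measurable (ε n))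
    (hx : ∀ n, Measurable (x n)) : Measurable (dataSeq f ε x) :=
  measurable_pi_lambda _ fun k => (hx k).prodMk (measurable_obs hf (hε k) (hx k))

theorem measurable_history (hf : Measurable f) (hε : ∀ n, Measurable (ε n))
    (hX : ∀ n, Measurable (X n)) (hx : ∀ n, Measurable (x n)) (n : ℕ) :
    Measurable (history f ε X x n) :=
  hf.prodMk <| measurable_pi_lambda _ fun k =>
    (hX k).prodMk ((hx k).prodMk (measurable_obs hf (hε k) (hx k)))

/-- The filtration generated by the data. -/
def dataFiltration (hf : Measurable f) (hε : ∀ n, Measurable (ε n)) (hx : ∀ n, Measurable (x n)) :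
    Filtration ℕ ‹MeasurableSpace Ω› where
  seq n := MeasurableSpace.comap (data f ε x n) inferInstance
  mono' n k hnk := by
    have h : Measurable fun (d : Fin k → 𝕏 × ℝ) (i : Fin n) => d (Fin.castLE hnk i) := by fun_prop
    exact (h.comp (comap_measurable (data f ε x k))).comap_le
  le' n := (measurable_data hf hε hx n).comap_le

/-- The filtration generated by the history. -/
def historyFiltration (hf : Measurable f) (hε : ∀ n, Measurable (ε n))
    (hX : ∀ n, Measurable (X n)) (hx : ∀ n, Measurable (x n)) :
    Filtration ℕ ‹MeasurableSpace Ω› where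
  seq n := MeasurableSpace.comap (history f ε X x n) inferInstance
  mono' n k hnk := by
    have h : Measurable fun (d : (𝕏 → ℝ) × (Fin k → Set 𝕏 × 𝕏 × ℝ)) =>
        (d.1, fun i : Fin n => d.2 (Fin.castLE hnk i)) := by fun_prop
    exact (h.comp (comap_measurable (history f ε X x k))).comap_le
  le' n := (measurable_history hf hε hX hx n).comap_le

theorem iSup_dataFiltration (hf : Measurable f) (hε : ∀ n, Measurable (ε n))
    (hx : ∀ n, Measurable (x n)) :
    ⨆ n, dataFiltration hf hε hx n = dataSigma f ε x := by
  apply le_antisymm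
  · refine iSup_le fun n => ?_
    have h : Measurable fun (d : ℕ → 𝕏 × ℝ) (i : Fin n) => d i := by fun_prop
    exact (h.comp (comap_measurable (dataSeq f ε x))).comap_le
  · refine Measurable.comap_le (@measurable_pi_lambda _ _ _ (⨆ n, dataFiltration hf hε hx n) _ _
      fun k => ?_)
    have h : Measurable fun d : Fin (k + 1) → 𝕏 × ℝ => d (Fin.last k) := by fun_prop
    exact (h.comp (comap_measurable (data f ε x (k + 1)))).mono
      (le_iSup (fun n => (dataFiltration hf hε hx n : MeasurableSpace Ω)) (k + 1)) le_rfl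

open Classical in
/-- The number of evaluations at `z` among the first `n`. -/
noncomputable def visits (x : ℕ → Ω → 𝕏) (z : 𝕏) (n : ℕ) (ω : Ω) : ℕ :=
  Nat.count (fun k => x k ω = z) n

/-- The event that step `k` is one of the first `m` evaluations at `z`. -/
def earlyVisit (x : ℕ → Ω → 𝕏) (z : 𝕏) (m k : ℕ) : Set Ω :=
  {ω | x k ω = z ∧ visits x z k ω < m}

omit [MeasurableSpace Ω] [Finite 𝕏] [MeasurableSpace 𝕏] [MeasurableSingletonClass 𝕏] in
-- Truncating at `m` visits makes the sample size exactly `m` once `m` visits have occurred, while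
-- each selection is still decided before its noise is revealed.
theorem sum_indicator_earlyVisit (x : ℕ → Ω → 𝕏) (z : 𝕏) (m n : ℕ) (ω : Ω) :
    ∑ k ∈ Finset.range n, (earlyVisit x z m k).indicator (fun _ => (1 : ℝ)) ω
      = (min (visits x z n ω) m : ℕ) := by
  classical
  induction n with
  | zero => simp [visits]
  | succ n ih =>
    rw [Finset.sum_range_succ, ih]
    have hcount : visits x z (n + 1) ω = visits x z n ω + if x n ω = z then 1 else 0 := by
      simp only [visits, Nat.count_succ]
    have hind : (earlyVisit x z m n).indicator (fun _ => (1 : ℝ)) ω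
        = ((if x n ω = z ∧ visits x z n ω < m then 1 else 0 : ℕ) : ℝ) := by
      simp [earlyVisit, Set.indicator_apply]
    rw [hind, ← Nat.cast_add, hcount]
    congr 1
    split_ifs <;> grind

omit [MeasurableSpace Ω] [Finite 𝕏] in
theorem measurable_visits {𝒢 : MeasurableSpace Ω} {z : 𝕏} {n : ℕ}
    (hx : ∀ k < n, Measurable[𝒢] (x k)) : Measurable[𝒢] (visits x z n) := by
  classical
  induction n with
  | zero =>
    have h : visits x z 0 = fun _ => 0 := by funext ω; simp only [visits, Nat.count_zero]
    rw [h]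
    exact measurable_const
  | succ n ih =>
    have h : visits x z (n + 1) = fun ω => visits x z n ω + if x n ω = z then 1 else 0 := by
      funext ω; simp only [visits, Nat.count_succ]
    rw [h]
    exact (ih fun k hk => hx k (by omega)).add (Measurable.ite
      (hx n (by omega) (measurableSet_singleton z)) measurable_const measurable_const)

omit [MeasurableSpace Ω] [Finite 𝕏] in
theorem measurableSet_le_visits {𝒢 : MeasurableSpace Ω} {z : 𝕏} {n : ℕ} (m : ℕ)
    (hx : ∀ k < n, Measurable[𝒢] (x k)) : MeasurableSet[𝒢] {ω | m ≤ visits x z n ω} :=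
  measurableSet_le measurable_const (measurable_visits hx)

omit [MeasurableSpace Ω] [Finite 𝕏] in
theorem measurableSet_earlyVisit {𝒢 : MeasurableSpace Ω} {z : 𝕏} {m n : ℕ}
    (hx : ∀ k ≤ n, Measurable[𝒢] (x k)) : MeasurableSet[𝒢] (earlyVisit x z m n) :=
  (hx n le_rfl (measurableSet_singleton z)).inter
    (measurableSet_lt (measurable_visits fun k hk => hx k hk.le) measurable_const)

omit [MeasurableSpace Ω] [Finite 𝕏] [MeasurableSpace 𝕏] [MeasurableSingletonClass 𝕏] in
theorem visits_mono (x : ℕ → Ω → 𝕏) (z : 𝕏) (ω : Ω) : Monotone fun n => visits x z n ω := by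
  classical
  exact fun a b h => Nat.count_monotone _ h

omit [MeasurableSpace Ω] [Finite 𝕏] [MeasurableSpace 𝕏] [MeasurableSingletonClass 𝕏] in
theorem exists_le_visits {z : 𝕏} {ω : Ω} (h : ∃ᶠ k in atTop, x k ω = z) (m : ℕ) :
    ∃ n, m ≤ visits x z n ω := by
  classical
  exact ⟨_, (Nat.count_nth_of_infinite (Nat.frequently_atTop_iff_infinite.1 h) m).ge⟩

end Measurability

/-! ### Repeated evaluation at a point removes its uncertainty. -/

section Learning

variable {Ω 𝕏 : Type*} [MeasurableSpace Ω] [Finite 𝕏] [MeasurableSpace 𝕏]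
  [MeasurableSingletonClass 𝕏] {P : Measure Ω} [IsProbabilityMeasure P] {σsq : ℝ≥0}
  {f : Ω → 𝕏 → ℝ} {ε : ℕ → Ω → ℝ} {X : ℕ → Ω → Set 𝕏} {x : ℕ → Ω → 𝕏}

omit [Finite 𝕏] [MeasurableSingletonClass 𝕏] in
theorem IsGPModel.memLp_prior (h : IsGPModel P σsq f ε X x) (z : 𝕏) :
    MemLp (fun ω => f ω z) 2 P :=
  (h.gaussian_prior.hasGaussianLaw_eval z).memLp_two

omit [Finite 𝕏] [MeasurableSingletonClass 𝕏] in
theorem IsGPModel.memLp_noise (h : IsGPModel P σsq f ε X x) (n : ℕ) : MemLp (ε n) 2 P := by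
  have hid : MemLp id 2 (P.map (ε n)) := by
    rw [h.noise_law n]
    exact memLp_id_gaussianReal 2
  exact (memLp_map_measure_iff hid.1 (h.measurable_noise n).aemeasurable).1 hid

omit [Finite 𝕏] [MeasurableSingletonClass 𝕏] in
theorem IsGPModel.integral_noise (h : IsGPModel P σsq f ε X x) (n : ℕ) : ∫ ω, ε n ω ∂P = 0 := by
  have := integral_map (μ := P) (h.measurable_noise n).aemeasurable (f := fun t : ℝ => t)
    (by fun_prop)
  rw [← this, h.noise_law n, integral_id_gaussianReal]

omit [Finite 𝕏] [MeasurableSingletonClass 𝕏] in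
theorem IsGPModel.integral_sq_noise (h : IsGPModel P σsq f ε X x) (n : ℕ) :
    ∫ ω, ε n ω ^ 2 ∂P = σsq := by
  have := integral_map (μ := P) (h.measurable_noise n).aemeasurable (f := fun t : ℝ => t ^ 2)
    (by fun_prop)
  rw [← this, h.noise_law n]
  have hv := variance_fun_id_gaussianReal (μ := 0) (v := σsq)
  rw [variance_eq_integral (by fun_prop), integral_id_gaussianReal] at hv
  simpa using hv

omit [Finite 𝕏] in
theorem sum_measureReal_earlyVisit_le (hx : ∀ n, Measurable (x n)) (z : 𝕏) (m n : ℕ) :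
    ∑ k ∈ Finset.range n, P.real (earlyVisit x z m k) ≤ m := by
  have hA : ∀ k, MeasurableSet (earlyVisit x z m k) := fun k =>
    measurableSet_earlyVisit fun j _ => hx j
  have hint : ∀ k, Integrable ((earlyVisit x z m k).indicator fun _ => (1 : ℝ)) P := fun k =>
    (integrable_const _).indicator (hA k)
  calc ∑ k ∈ Finset.range n, P.real (earlyVisit x z m k)
      = ∫ ω, ∑ k ∈ Finset.range n, (earlyVisit x z m k).indicator (fun _ => (1 : ℝ)) ω ∂P := by
        rw [integral_finsetSum _ fun k _ => hint k]
        simp [integral_indicator_const, hA]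
    _ ≤ ∫ _, (m : ℝ) ∂P := by
        refine integral_mono (integrable_finsetSum _ fun k _ => hint k) (integrable_const _)
          fun ω => ?_
        simp only [sum_indicator_earlyVisit]
        exact_mod_cast min_le_right _ _
    _ = m := by simp

/-- The second moment of the total noise of the first `m` evaluations at `z`. -/
theorem integral_sq_sum_earlyVisit_noise_le (h : IsGPModel P σsq f ε X x)
    (hX : ∀ n, Measurable (X n)) (hx : ∀ n, Measurable (x n)) (z : 𝕏) (m n : ℕ) :
    ∫ ω, (∑ k ∈ Finset.range n, (earlyVisit x z m k).indicator (ε k) ω) ^ 2 ∂P ≤ σsq * m := by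
  -- The past must include `x n`, since whether step `n` is an early visit depends on it.
  set H : ∀ n, Ω → ((𝕏 → ℝ) × (Fin n → Set 𝕏 × 𝕏 × ℝ)) × Set 𝕏 × 𝕏 :=
    fun n ω => (history f ε X x n ω, X n ω, x n ω)
  have hH : ∀ n, Measurable (H n) := fun n =>
    (measurable_history h.measurable_f h.measurable_noise hX hx n).prodMk ((hX n).prodMk (hx n))
  have past : ∀ n, ∀ k < n, Measurable[MeasurableSpace.comap (H n) inferInstance]
      fun ω => (f ω, x k ω, obs f ε x k ω) := fun n k hk => by
    have : Measurable fun p : ((𝕏 → ℝ) × (Fin n → Set 𝕏 × 𝕏 × ℝ)) × Set 𝕏 × 𝕏 =>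
      (p.1.1, (p.1.2 ⟨k, hk⟩).2.1, (p.1.2 ⟨k, hk⟩).2.2) := by fun_prop
    exact this.comp (comap_measurable (H n))
  have point : ∀ n, ∀ k ≤ n, Measurable[MeasurableSpace.comap (H n) inferInstance] (x k) :=
    fun n k hk => by
      rcases hk.lt_or_eq with hk | rfl
      · exact (measurable_fst.comp measurable_snd).comp (past n k hk)
      · exact (measurable_snd.comp measurable_snd).comp (comap_measurable (H k))
  -- Since `f` is part of the history, past noise is recovered as `y_k - f(x_k)`.
  have noise : ∀ n, ∀ k < n, Measurable[MeasurableSpace.comap (H n) inferInstance] (ε k) :=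
    fun n k hk => by
      have hev : Measurable fun p : (𝕏 → ℝ) × 𝕏 × ℝ => p.2.2 - p.1 p.2.1 :=
        (measurable_snd.comp measurable_snd).sub
          (measurable_eval_random_point (f := fun p : (𝕏 → ℝ) × 𝕏 × ℝ => p.1)
            (x := fun _ p => p.2.1) (n := 0) measurable_fst (measurable_fst.comp measurable_snd))
      have : ε k = (fun p : (𝕏 → ℝ) × 𝕏 × ℝ => p.2.2 - p.1 p.2.1) ∘
          fun ω => (f ω, x k ω, obs f ε x k ω) := by
        funext ω; simp [obs]
      rw [this]
      exact hev.comp (past n k hk)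
  have early : ∀ n, ∀ k ≤ n,
      MeasurableSet[MeasurableSpace.comap (H n) inferInstance] (earlyVisit x z m k) := fun n k hk =>
    measurableSet_earlyVisit fun j hj => point n j (hj.trans hk)
  rw [integral_sq_sum_indicator_noise (v := σsq)
    (𝒢 := fun n => MeasurableSpace.comap (H n) inferInstance) (fun n => (hH n).comap_le)
    h.memLp_noise h.integral_noise h.integral_sq_noise
    (fun n => (IndepFun_iff_Indep _ _ _).1 (h.noise_indep n)) (fun n => early n n le_rfl)
    (fun n => @Finset.measurable_sum _ _ _ _ _ _ (_) _ _ fun k hk =>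
      have hk := Finset.mem_range.1 hk
      (noise n k hk).indicator (early n k hk.le))]
  exact mul_le_mul_of_nonneg_left (sum_measureReal_earlyVisit_le hx z m n) σsq.2

/-- The mean of the first `m` observations at `z` is a data-measurable estimator of `f z`; on the
event of `m` visits its error is an average of `m` orthogonal noises. -/
theorem setIntegral_condVar_visits_le (h : IsGPModel P σsq f ε X x)
    (hX : ∀ n, Measurable (X n)) (hx : ∀ n, Measurable (x n)) (z : 𝕏) {m : ℕ} (hm : 0 < m) (n : ℕ) :
    ∫ ω in {ω | m ≤ visits x z n ω}, condVar (dataSigma f ε x) (fun ω => f ω z) P ω ∂P ≤ σsq / m := by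
  have hm' : (0 : ℝ) < m := by exact_mod_cast hm
  have hle : dataSigma f ε x ≤ ‹MeasurableSpace Ω› :=
    (measurable_dataSeq h.measurable_f h.measurable_noise hx).comap_le
  have hpt : ∀ k, Measurable[dataSigma f ε x] fun ω => (x k ω, obs f ε x k ω) := fun k =>
    (measurable_pi_apply k).comp (comap_measurable (dataSeq f ε x))
  have hx𝒟 : ∀ k, Measurable[dataSigma f ε x] (x k) := fun k => measurable_fst.comp (hpt k)
  have hA : ∀ k, MeasurableSet[dataSigma f ε x] (earlyVisit x z m k) := fun k =>
    measurableSet_earlyVisit fun j _ => hx𝒟 j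
  have hE : MeasurableSet[dataSigma f ε x] {ω | m ≤ visits x z n ω} :=
    measurableSet_le_visits m fun j _ => hx𝒟 j
  set Y : Ω → ℝ := fun ω =>
    (m : ℝ)⁻¹ * ∑ k ∈ Finset.range n, (earlyVisit x z m k).indicator (obs f ε x k) ω
  have hYm : Measurable[dataSigma f ε x] Y := (@Finset.measurable_sum _ _ _ _ _ _ (_) _ _ fun k _ =>
    (measurable_snd.comp (hpt k)).indicator (hA k)).const_mul _
  have hobs : ∀ k, (earlyVisit x z m k).indicator (obs f ε x k)
      = (earlyVisit x z m k).indicator (fun ω => f ω z + ε k ω) := fun k => by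
    refine Set.indicator_congr fun ω hω => ?_
    simp [obs, hω.1]
  have hobsL : ∀ k, MemLp ((earlyVisit x z m k).indicator (obs f ε x k)) 2 P := fun k => by
    have hsum : MemLp (fun ω => f ω z + ε k ω) 2 P := (h.memLp_prior z).add (h.memLp_noise k)
    rw [hobs]
    exact hsum.indicator (hle _ (hA k))
  have hsumL : MemLp (fun ω => ∑ k ∈ Finset.range n,
      (earlyVisit x z m k).indicator (obs f ε x k) ω) 2 P :=
    memLp_finsetSum _ fun k _ => hobsL k
  have hYL : MemLp Y 2 P := hsumL.const_mul _
  set S : Ω → ℝ := fun ω => ∑ k ∈ Finset.range n, (earlyVisit x z m k).indicator (ε k) ω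
  have hSL : MemLp S 2 P := memLp_finsetSum _ fun k _ => (h.memLp_noise k).indicator (hle _ (hA k))
  -- Dividing by `m` is right only here, where exactly `m` terms are selected.
  have herr : ∀ ω ∈ {ω | m ≤ visits x z n ω}, (f ω z - Y ω) ^ 2 = ((m : ℝ) ^ 2)⁻¹ * S ω ^ 2 := by
    intro ω hω
    have hsum : ∑ k ∈ Finset.range n, (earlyVisit x z m k).indicator (obs f ε x k) ω
        = m * f ω z + S ω := by
      have h1 := sum_indicator_earlyVisit x z m n ω
      rw [min_eq_right hω] at h1
      rw [← h1, Finset.sum_mul, ← Finset.sum_add_distrib]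
      refine Finset.sum_congr rfl fun k _ => ?_
      rw [hobs]
      by_cases hk : ω ∈ earlyVisit x z m k <;> simp [hk]
    simp only [Y, hsum]
    field_simp
    ring
  calc _ ≤ ∫ ω in {ω | m ≤ visits x z n ω}, (f ω z - Y ω) ^ 2 ∂P :=
        setIntegral_condVar_le hle (h.memLp_prior z) hYL hYm.stronglyMeasurable hE
    _ = ∫ ω in {ω | m ≤ visits x z n ω}, ((m : ℝ) ^ 2)⁻¹ * S ω ^ 2 ∂P :=
        setIntegral_congr_fun (hle _ hE) herr
    _ ≤ ∫ ω, ((m : ℝ) ^ 2)⁻¹ * S ω ^ 2 ∂P :=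
        setIntegral_le_integral (hSL.integrable_sq.const_mul _)
          (Eventually.of_forall fun ω => by positivity)
    _ ≤ ((m : ℝ) ^ 2)⁻¹ * (σsq * m) := by
        rw [integral_const_mul]
        exact mul_le_mul_of_nonneg_left (integral_sq_sum_earlyVisit_noise_le h hX hx z m n)
          (by positivity)
    _ = σsq / m := by field_simp

/-- The value of `f` at a point that is evaluated infinitely often is known in the limit. -/
theorem condVar_eq_zero_of_frequently_visited (h : IsGPModel P σsq f ε X x)
    (hX : ∀ n, Measurable (X n)) (hx : ∀ n, Measurable (x n)) (z : 𝕏) :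
    ∀ᵐ ω ∂P, (∃ᶠ k in atTop, x k ω = z) →
      condVar (dataSigma f ε x) (fun ω => f ω z) P ω = 0 := by
  set V := condVar (dataSigma f ε x) (fun ω => f ω z) P
  have hV0 : 0 ≤ᵐ[P] V := condVar_ae_nonneg _
  have hVint : Integrable V P := integrable_condVar
  have hE : ∀ m n, MeasurableSet {ω | m ≤ visits x z n ω} := fun m n =>
    measurableSet_le_visits m fun j _ => hx j
  -- The bound does not depend on `n`, so it passes to the increasing union; letting `m` grow then
  -- annihilates the integral over the intersection of the `B m`.
  set B : ℕ → Set Ω := fun m => ⋃ n, {ω | m ≤ visits x z n ω}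
  have hBm : ∀ m, MeasurableSet (B m) := fun m => MeasurableSet.iUnion (hE m)
  have hBle : ∀ m : ℕ, 0 < m → ∫ ω in B m, V ω ∂P ≤ σsq / m := fun m hm =>
    le_of_tendsto' (tendsto_setIntegral_of_monotone (hE m)
      (fun a b hab ω hω => le_trans (α := ℕ) hω (visits_mono x z ω hab)) hVint.integrableOn)
      fun n => setIntegral_condVar_visits_le h hX hx z hm n
  set A := ⋂ m, B m
  have hAm : MeasurableSet A := MeasurableSet.iInter hBm
  have hAle : ∀ m : ℕ, 0 < m → ∫ ω in A, V ω ∂P ≤ σsq / m := fun m hm =>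
    (setIntegral_mono_set hVint.integrableOn (ae_restrict_of_ae hV0)
      (LE.le.eventuallyLE (Set.iInter_subset B m))).trans (hBle m hm)
  have hA0 : ∫ ω in A, V ω ∂P = 0 :=
    le_antisymm (ge_of_tendsto (tendsto_const_div_atTop_nhds_zero_nat (σsq : ℝ))
      (eventually_atTop.2 ⟨1, fun m hm => hAle m hm⟩))
      (integral_nonneg_of_ae (ae_restrict_of_ae hV0))
  have hzero := (setIntegral_eq_zero_iff_of_nonneg_ae (ae_restrict_of_ae hV0)
    hVint.integrableOn).1 hA0
  filter_upwards [(ae_restrict_iff' hAm).1 hzero] with ω hω hfreq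
  exact hω (Set.mem_iInter.2 fun m => Set.mem_iUnion.2 (exists_le_visits hfreq m))

end Learning

/-! ### Identification of the limiting posterior. -/

section Consistency

variable {Ω 𝕏 : Type*} [MeasurableSpace Ω] [Finite 𝕏] [MeasurableSpace 𝕏]
  [MeasurableSingletonClass 𝕏] {P : Measure Ω} [IsProbabilityMeasure P] {σsq : ℝ≥0} {n₀ : ℕ}
  {O : (𝕏 → ℝ) → Set 𝕏}
  {f : Ω → 𝕏 → ℝ} {ε : ℕ → Ω → ℝ} {X : ℕ → Ω → Set 𝕏} {x : ℕ → Ω → 𝕏}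

/-- The posterior distribution of `f` given all evaluations. -/
noncomputable def limitLaw (P : Measure Ω) [IsProbabilityMeasure P]
    (f : Ω → 𝕏 → ℝ) (ε : ℕ → Ω → ℝ) (x : ℕ → Ω → 𝕏) (ω : Ω) : Measure (𝕏 → ℝ) :=
  condDistrib f (dataSeq f ε x) P (dataSeq f ε x ω)

instance (ω : Ω) : IsProbabilityMeasure (limitLaw P f ε x ω) := by
  unfold limitLaw; infer_instance

/-- Posterior probabilities converge. -/
theorem tendsto_posteriorLaw (hf : Measurable f) (hε : ∀ n, Measurable (ε n))
    (hx : ∀ n, Measurable (x n)) {s : Set (𝕏 → ℝ)} (hs : MeasurableSet s) :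
    ∀ᵐ ω ∂P, Tendsto (fun n => (posteriorLaw P f ε x n ω).real s) atTop
      (𝓝 ((limitLaw P f ε x ω).real s)) := by
  have hfin : ∀ᵐ ω ∂P, ∀ n, (posteriorLaw P f ε x n ω).real s
      = (P[(f ⁻¹' s).indicator fun _ => (1 : ℝ) | dataFiltration hf hε hx n]) ω :=
    ae_all_iff.2 fun n => condDistrib_ae_eq_condExp (measurable_data hf hε hx n) hf hs
  have hlim := condDistrib_ae_eq_condExp (μ := P) (measurable_dataSeq hf hε hx) hf hs
  filter_upwards [hfin, hlim, tendsto_ae_condExp (μ := P) (ℱ := dataFiltration hf hε hx)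
    ((f ⁻¹' s).indicator fun _ => (1 : ℝ))] with ω h1 h2 h3
  rw [iSup_dataFiltration] at h3
  simp only [h1]
  rwa [← h2] at h3

/-- Posterior standard deviations converge. -/
theorem tendsto_posteriorSD (h : IsGPModel P σsq f ε X x) (hx : ∀ n, Measurable (x n)) (z : 𝕏) :
    ∀ᵐ ω ∂P, Tendsto (fun n => posteriorSD P f ε x n ω z) atTop
      (𝓝 √(condVar (dataSigma f ε x) (fun ω => f ω z) P ω)) := by
  have hfin : ∀ᵐ ω ∂P, ∀ n, Var[fun g : 𝕏 → ℝ => g z; posteriorLaw P f ε x n ω]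
      = condVar (dataFiltration h.measurable_f h.measurable_noise hx n) (fun ω => f ω z) P ω :=
    ae_all_iff.2 fun n => variance_condDistrib_ae_eq_condVar
      (measurable_data h.measurable_f h.measurable_noise hx n) h.measurable_f (h.memLp_prior z)
  filter_upwards [hfin, tendsto_ae_condVar
    (dataFiltration h.measurable_f h.measurable_noise hx) (h.memLp_prior z)] with ω h1 h2
  rw [iSup_dataFiltration] at h2
  simp only [posteriorSD, h1]
  exact (Real.continuous_sqrt.tendsto _).comp h2

theorem tendsto_sum_range_atTop_of_tendsto_pos {u : ℕ → ℝ} {c : ℝ} (hu : Tendsto u atTop (𝓝 c))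
    (hc : 0 < c) : Tendsto (fun n => ∑ k ∈ Finset.range n, u k) atTop atTop := by
  refine (Tendsto.atTop_mul_pos hc tendsto_natCast_atTop_atTop hu.cesaro).congr' ?_
  filter_upwards [eventually_gt_atTop 0] with n hn
  field_simp

/-- A set that keeps positive posterior probability is sampled infinitely often. -/
theorem frequently_sampled (h : IsGPModel P σsq f ε X x) (hB : IsPSBAX P n₀ O f ε X x)
    {Z : Set 𝕏} (hZ : MeasurableSet {g : 𝕏 → ℝ | O g = Z}) :
    ∀ᵐ ω ∂P, 0 < (limitLaw P f ε x ω).real {g | O g = Z} → ∃ᶠ n in atTop, X n ω = Z := by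
  set ℋ := historyFiltration h.measurable_f h.measurable_noise hB.measurable_set hB.measurable_point
  -- The shift by one reflects that `X k` is known only at time `k + 1`; conditioning `s (n + 1)` on
  -- `ℋ n` then gives the posterior sampling probability.
  set s : ℕ → Set Ω := fun n => n.casesOn ∅ fun k => {ω | X k ω = Z}
  have hs : ∀ n, MeasurableSet[ℋ n] (s n) := by
    intro n
    cases n with
    | zero => exact @MeasurableSet.empty _ (ℋ 0)
    | succ k =>
      have h1 : Measurable fun p : (𝕏 → ℝ) × (Fin (k + 1) → Set 𝕏 × 𝕏 × ℝ) =>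
        (p.2 (Fin.last k)).1 := by fun_prop
      have h2 : Measurable[ℋ (k + 1)] (X k) :=
        h1.comp (comap_measurable (history f ε X x (k + 1)))
      exact h2 (measurableSet_singleton Z)
  have hps : ∀ᵐ ω ∂P, ∀ n, n₀ ≤ n → (P[(s (n + 1)).indicator (1 : Ω → ℝ) | ℋ n]) ω
      = (posteriorLaw P f ε x n ω).real {g | O g = Z} := by
    refine ae_all_iff.2 fun n => ?_
    by_cases hn : n₀ ≤ n
    · filter_upwards [hB.posterior_sampling n hn Z] with ω hω _
      exact hω
    · exact Eventually.of_forall fun ω hn' => absurd hn' hn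
  filter_upwards [hps, ae_mem_limsup_atTop_iff P hs,
    tendsto_posteriorLaw h.measurable_f h.measurable_noise hB.measurable_point hZ]
    with ω h1 h2 h3 hpos
  have hlim : Tendsto (fun n => (P[(s (n + 1)).indicator (1 : Ω → ℝ) | ℋ n]) ω) atTop
      (𝓝 ((limitLaw P f ε x ω).real {g | O g = Z})) :=
    h3.congr' ((eventually_ge_atTop n₀).mono fun n hn => (h1 n hn).symm)
  have hmem := h2.2 (tendsto_sum_range_atTop_of_tendsto_pos hlim hpos)
  rw [mem_limsup_iff_frequently_mem, ← map_add_atTop_eq_nat 1, frequently_map] at hmem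
  exact hmem

omit [MeasurableSpace 𝕏] [MeasurableSingletonClass 𝕏] in
/-- If a nonempty set is sampled infinitely often and the uncertainty vanishes at all points
evaluated infinitely often, then it vanishes on the whole set. -/
theorem sd_limit_nonpos_of_frequently_sampled {Xs : ℕ → Set 𝕏} {xs : ℕ → 𝕏} {sd : ℕ → 𝕏 → ℝ}
    {L : 𝕏 → ℝ} (hlim : ∀ z, Tendsto (fun n => sd n z) atTop (𝓝 (L z)))
    (hvis : ∀ z, (∃ᶠ n in atTop, xs n = z) → L z = 0)
    (hmax : ∀ᶠ n in atTop, (Xs n).Nonempty → xs n ∈ Xs n ∧ IsMaxOn (sd n) (Xs n) (xs n))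
    {Z : Set 𝕏} (hZ : ∃ᶠ n in atTop, Xs n = Z) {z : 𝕏} (hz : z ∈ Z) : L z ≤ 0 := by
  -- Pigeonhole over the finite set `𝕏`.
  obtain ⟨w, hw⟩ : ∃ w, ∃ᶠ n in atTop, Xs n = Z ∧ xs n = w := by
    by_contra hcon
    push Not at hcon
    refine hZ ((eventually_all.2 hcon).mono fun n hn hXn => hn (xs n) hXn rfl)
  rw [← hvis w (hw.mono fun n hn => hn.2)]
  refine le_of_tendsto_of_tendsto_of_frequently (hlim z) (hlim w) ?_
  refine (hw.and_eventually hmax).mono fun n hn => ?_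
  obtain ⟨⟨hXn, hxn⟩, hn⟩ := hn
  rw [hXn, hxn] at hn
  exact (hn ⟨z, hz⟩).2 hz

omit [MeasurableSpace 𝕏] [MeasurableSingletonClass 𝕏] in
/-- At most one target set is compatible with knowing `f` on all candidate target sets. -/
theorem eq_of_ae_known (hO : ComplementIndependent O) {μ : Measure (𝕏 → ℝ)} {c : 𝕏 → ℝ}
    {Z Z' : Set 𝕏} (hc : ∀ z ∈ Z ∪ Z', ∀ᵐ g ∂μ, g z = c z)
    (hZ : μ {g | O g = Z} ≠ 0) (hZ' : μ {g | O g = Z'} ≠ 0) : Z = Z' := by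
  have hall : ∀ᵐ g ∂μ, ∀ z ∈ Z ∪ Z', g z = c z := by
    refine ae_all_iff.2 fun z => ?_
    by_cases hz : z ∈ Z ∪ Z'
    · filter_upwards [hc z hz] with g hg _ using hg
    · exact Eventually.of_forall fun g h => absurd h hz
  obtain ⟨g, hg, hgc⟩ := ((frequently_ae_mem_iff.2 hZ).and_eventually hall).exists
  obtain ⟨g', hg', hgc'⟩ := ((frequently_ae_mem_iff.2 hZ').and_eventually hall).exists
  replace hg : O g = Z := hg
  replace hg' : O g' = Z' := hg'
  rw [← hg, ← hg']
  exact hO g g' ⟨Z ∪ Z', by rw [hg, hg'], fun z hz => by rw [hgc z hz, hgc' z hz]⟩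

/-- The true target set has positive limiting posterior probability. -/
theorem limitLaw_target_pos (hf : Measurable f) (hε : ∀ n, Measurable (ε n))
    (hx : ∀ n, Measurable (x n)) {Z : Set 𝕏} (hZ : MeasurableSet {g : 𝕏 → ℝ | O g = Z}) :
    ∀ᵐ ω ∂P, O (f ω) = Z → limitLaw P f ε x ω {g | O g = Z} ≠ 0 := by
  set s : Set (𝕏 → ℝ) := {g | O g = Z}
  have hW := measurable_dataSeq hf hε hx
  -- The data giving the target zero mass: integrating that mass over `t` yields the probability
  -- that such data occur together with the target.
  set t : Set (ℕ → 𝕏 × ℝ) := {d | condDistrib f (dataSeq f ε x) P d s = 0}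
  have ht : MeasurableSet t :=
    (Kernel.measurable_coe (condDistrib f (dataSeq f ε x) P) hZ) (measurableSet_singleton 0)
  have hzero : P (dataSeq f ε x ⁻¹' t ∩ f ⁻¹' s) = 0 := by
    rw [← setLIntegral_preimage_condDistrib hW hf.aemeasurable hZ ht]
    exact setLIntegral_eq_zero (hW ht) fun ω hω => hω
  filter_upwards [measure_eq_zero_iff_ae_notMem.1 hzero] with ω hω hO' hlaw
  exact hω ⟨hlaw, hO'⟩

/-- Zero limiting standard deviation on `Z` is zero variance under `limitLaw`, which forces each
coordinate to equal its mean. -/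
theorem ae_known_of_frequently_sampled (h : IsGPModel P σsq f ε X x)
    (hB : IsPSBAX P n₀ O f ε X x) :
    ∀ᵐ ω ∂P, ∀ Z : Set 𝕏, (∃ᶠ n in atTop, X n ω = Z) → ∀ z ∈ Z,
      ∀ᵐ g ∂(limitLaw P f ε x ω), g z = ∫ g', g' z ∂(limitLaw P f ε x ω) := by
  have hx := hB.measurable_point
  have hW := measurable_dataSeq h.measurable_f h.measurable_noise hx
  have hmax : ∀ᵐ ω ∂P, ∀ n, n₀ ≤ n → (X n ω).Nonempty →
      x n ω ∈ X n ω ∧ IsMaxOn (posteriorSD P f ε x n ω) (X n ω) (x n ω) := by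
    refine ae_all_iff.2 fun n => ?_
    by_cases hn : n₀ ≤ n
    · filter_upwards [hB.argmax n hn] with ω hω _ using hω
    · exact Eventually.of_forall fun ω hn' => absurd hn' hn
  filter_upwards [hmax, ae_all_iff.2 fun z => tendsto_posteriorSD h hx z,
    ae_all_iff.2 fun z => condVar_eq_zero_of_frequently_visited h hB.measurable_set hx z,
    ae_all_iff.2 fun z => condVar_ae_nonneg (m := dataSigma f ε x) (P := P) fun ω => f ω z,
    ae_all_iff.2 fun z => variance_condDistrib_ae_eq_condVar hW h.measurable_f (h.memLp_prior z),
    ae_all_iff.2 fun z => memLp_eval_condDistrib hW h.measurable_f (h.memLp_prior z)]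
    with ω h1 h2 h3 h4 h5 h6 Z hZ z hz
  have hle := sd_limit_nonpos_of_frequently_sampled h2
    (fun w hw => by rw [h3 w hw, Real.sqrt_zero])
    ((eventually_ge_atTop n₀).mono fun n hn => h1 n hn) hZ hz
  have hvar : Var[fun g : 𝕏 → ℝ => g z; limitLaw P f ε x ω] = 0 :=
    (h5 z).trans ((Real.sqrt_eq_zero (h4 z)).1 (le_antisymm hle (Real.sqrt_nonneg _)))
  exact ae_eq_integral_of_variance_eq_zero (h6 z) hvar

omit [MeasurableSpace 𝕏] [MeasurableSingletonClass 𝕏] in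
theorem measureReal_target_eq_ite (hO_meas : ∀ Z : Set 𝕏, MeasurableSet {g : 𝕏 → ℝ | O g = Z})
    {μ : Measure (𝕏 → ℝ)} [IsProbabilityMeasure μ] {T : Set 𝕏}
    (hT : ∀ Z, μ {g | O g = Z} ≠ 0 → Z = T) (Z : Set 𝕏) [Decidable (T = Z)] :
    μ.real {g | O g = Z} = if T = Z then 1 else 0 := by
  have hall : ∀ᵐ g ∂μ, O g = T := by
    have : ∀ᵐ g ∂μ, ∀ Z, O g = Z → Z = T := by
      refine ae_all_iff.2 fun Z => ?_
      by_cases hZ : μ {g | O g = Z} = 0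
      · filter_upwards [measure_eq_zero_iff_ae_notMem.1 hZ] with g hg hg' using absurd hg' hg
      · exact Eventually.of_forall fun g _ => hT Z hZ
    filter_upwards [this] with g hg using hg _ rfl
  split_ifs with hZ
  · subst hZ
    rw [measureReal_def, prob_compl_eq_zero_iff (hO_meas T) |>.1 hall, ENNReal.toReal_one]
  · have : μ {g | O g = Z} = 0 := by
      by_contra hne
      exact hZ (hT Z hne).symm
    simp [measureReal_def, this]

end Consistency

end PSBAX

theorem theorem1 {Ω 𝕏 : Type*} [MeasurableSpace Ω]
    [Finite 𝕏] [MeasurableSpace 𝕏] [MeasurableSingletonClass 𝕏]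
    (P : Measure Ω) [IsProbabilityMeasure P] (σsq : ℝ≥0) (n₀ : ℕ)
    (O : (𝕏 → ℝ) → Set 𝕏) (hO_meas : ∀ Z : Set 𝕏, MeasurableSet {g : 𝕏 → ℝ | O g = Z})
    (hO : PSBAX.ComplementIndependent O)
    (f : Ω → 𝕏 → ℝ) (ε : ℕ → Ω → ℝ) (X : ℕ → Ω → Set 𝕏) (x : ℕ → Ω → 𝕏)
    (hmodel : PSBAX.IsGPModel P σsq f ε X x)
    (hPSBAX : PSBAX.IsPSBAX P n₀ O f ε X x) :
    ∀ Z : Set 𝕏, ∀ᵐ ω ∂P,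
      Tendsto (fun n => (PSBAX.posteriorLaw P f ε x n ω).real {g | O g = Z}) atTop
        (𝓝 ({ω' | O (f ω') = Z}.indicator (fun _ => (1 : ℝ)) ω)) := by
  classical
  intro Z
  have hf := hmodel.measurable_f
  have hε := hmodel.measurable_noise
  have hx := hPSBAX.measurable_point
  filter_upwards [PSBAX.tendsto_posteriorLaw hf hε hx (hO_meas Z),
    -- There are finitely many subsets of `𝕏`, so one null set serves every candidate target.
    ae_all_iff.2 fun Z' => PSBAX.limitLaw_target_pos hf hε hx (hO_meas Z'),
    ae_all_iff.2 fun Z' => PSBAX.frequently_sampled hmodel hPSBAX (hO_meas Z'),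
    PSBAX.ae_known_of_frequently_sampled hmodel hPSBAX] with ω hlim hpos hfreq hknown
  have hT : ∀ Z', PSBAX.limitLaw P f ε x ω {g | O g = Z'} ≠ 0 → Z' = O (f ω) := by
    intro Z' hZ'
    have known : ∀ Y, PSBAX.limitLaw P f ε x ω {g | O g = Y} ≠ 0 → ∀ z ∈ Y,
        ∀ᵐ g ∂(PSBAX.limitLaw P f ε x ω), g z = ∫ g', g' z ∂(PSBAX.limitLaw P f ε x ω) :=
      fun Y hY => hknown Y (hfreq Y (ENNReal.toReal_pos hY (measure_ne_top _ _)))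
    exact PSBAX.eq_of_ae_known hO
      (fun z hz => hz.elim (known Z' hZ' z) (known _ (hpos _ rfl) z)) hZ' (hpos _ rfl)
  rw [PSBAX.measureReal_target_eq_ite hO_meas hT Z] at hlim
  simpa [Set.indicator_apply] using hlim
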